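/- Consider a rack-aware storage system with $n=\bar n u$ nodes arranged in $\bar n$ racks of $u$ nodes. A file of $B>0$ symbols is stored so that each node stores $\alpha\ge 0$ symbols and any $k\le n$ nodes suffice to retrieve the file. A failed node is repaired by a replacement node at the same position, which connects to some $l$ surviving nodes of its own rack ($0\le l<u$; intra-rack transmission is free) and to some $\bar d$ other racks, each of which uploads $\beta\ge 0$ symbols computed from the data of all its nodes; the repair bandwidth is $\bar d\beta$. Put $\bar k=\lfloor k/u\rfloor$, $u_0=k-\bar k u$, $\tilde u_0=\min\{u_0,l\}$, and assume $\bar d<\bar k$. Every finite sequence of repairs gives an information flow graph from the file (source) through the original and replacement nodes, with capacity $\alpha$ for each node, $\beta$ for each helper rack of each repair, and $\infty$ for all other edges. Let $B^*(\alpha,\beta)$ be the minimum, over all these graphs and all data collectors connecting to $k$ nodes present at the end, of the minimum cut between source and collector (the maximum possible file size). The pair $(\alpha,\beta)$ lies on the tradeoff curve (parameters of MET-RRCs) if $B=B^*(\alpha,\beta)$ and, in the case $\bar d>0$, any $l+1$ nodes of one rack (such as a replacement node with its $l$ local helpers, all recoverable from the at most $l\alpha+\bar d\beta$ symbols used in a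 repair) hold $(l+1)\alpha$ symbols of information, i.e. in every information flow graph the minimum cut between the source and these nodes is at least $(l+1)\alpha$. The MET-MSRR point is the point of this curve that minimizes first $\alpha$ and then the repair bandwidth (for $\bar d=0$, where the bandwidth vanishes, then $\beta$); the MET-MBRR point is the one that minimizes first the repair bandwidth and then $\alpha$. Then: (a) If $0<\bar d<\bar k$, both points exist and are unique. The MET-MSRR point is $$\alpha=\beta=\frac{B}{\bar k l+\tilde u_0+(u-l)\bar d},$$ and the MET-MBRR point is $$\alpha=\bar d\beta=\frac{B}{\bar k l+\tilde u_0+\frac{(u-l)(\bar d+1)}{2}}.$$ (b) If $\bar d=0<\bar k$ and $l\ge 1$, the MET-MSRR point exists and is unique, and it is $\beta=0$, $\alpha=\dfrac{B}{\bar k l+\tilde u_0}$. -/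

import Mathlib

open scoped ENNReal

/-- The nodes of a rack-aware storage system: the pair `(e, g)` is the `g`-th of the `u` nodes of
the `e`-th of the `nbar` racks. -/
abbrev RackNode (nbar u : ℕ) : Type := Fin nbar × Fin u

/-- One node repair: the failed node, the `l` surviving nodes of the host rack and the `dbar`
helper racks outside the host rack to which its replacement connects. -/
structure RackRepair (nbar u dbar l : ℕ) where
  failed : RackNode nbar u
  localHelpers : Finset (Fin u)
  card_localHelpers : localHelpers.card = l
  failed_notMem : failed.2 ∉ localHelpers
  helperRacks : Finset (Fin nbar)
  card_helperRacks : helperRacks.card = dbar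
  host_notMem : failed.1 ∉ helperRacks

/-- The vertices of the information flow graph of a storage system after `T` successive repairs.
* `origIn x` is the in-vertex of the original node `x`;
* `newIn t` is the in-vertex of the replacement node created by the `t`-th repair;
* `out i x` is the out-vertex of the node that sits at position `x` after the first `i` repairs;
* `relay t e` is the place in rack `e` where the symbols that `e` uploads during the `t`-th repair
  are computed from the data of all nodes of `e`. -/
inductive FlowVertex (nbar u T : ℕ) : Type
  | source : FlowVertex nbar u T
  | origIn (x : RackNode nbar u) : FlowVertex nbar u T
  | newIn (t : Fin T) : FlowVertex nbar u T
  | out (i : Fin (T + 1)) (x : RackNode nbar u) : FlowVertex nbar u T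
  | relay (t : Fin T) (e : Fin nbar) : FlowVertex nbar u T
  | collector : FlowVertex nbar u T
  deriving DecidableEq, Fintype

open Classical in
/-- The capacity of the edge between two vertices of the information flow graph given by the
repairs `h 0, h 1, …` and a data collector connecting to the final nodes at the positions `K`
(`0` means that there is no edge). -/
noncomputable def flowCapacity {nbar u dbar l T : ℕ} (α β : ℝ)
    (h : Fin T → RackRepair nbar u dbar l) (K : Finset (RackNode nbar u)) :
    FlowVertex nbar u T → FlowVertex nbar u T → ℝ≥0∞
  -- the file is distributed to the original nodes
  | .source, .origIn _ => ⊤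
  -- each node, original or replacement, stores `α` symbols
  | .origIn x, .out i y => if i = 0 ∧ y = x then ENNReal.ofReal α else 0
  | .newIn t, .out i y => if i = t.succ ∧ y = (h t).failed then ENNReal.ofReal α else 0
  -- a repair leaves the other nodes unchanged
  | .out i x, .out j y =>
      if ∃ t : Fin T, i = t.castSucc ∧ j = t.succ ∧ x = y ∧ x ≠ (h t).failed then ⊤ else 0
  -- the local helper nodes transmit freely to the replacement node
  | .out i x, .newIn t =>
      if i = t.castSucc ∧ x.1 = (h t).failed.1 ∧ x.2 ∈ (h t).localHelpers then ⊤ else 0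
  -- the nodes of a helper rack cooperate freely, and the rack uploads `β` symbols
  | .out i x, .relay t e =>
      if i = t.castSucc ∧ x.1 = e ∧ e ∈ (h t).helperRacks then ⊤ else 0
  | .relay t e, .newIn s => if t = s ∧ e ∈ (h t).helperRacks then ENNReal.ofReal β else 0
  -- the data collector
  | .out i x, .collector => if i = Fin.last T ∧ x ∈ K then ⊤ else 0
  | _, _ => 0

/-- The minimum, over all cuts separating the source from the data collector, of the total capacity
of the edges from the source side to the collector side. -/
noncomputable def flowMinCut {nbar u dbar l T : ℕ} (α β : ℝ)
    (h : Fin T → RackRepair nbar u dbar l) (K : Finset (RackNode nbar u)) : ℝ≥0∞ :=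
  ⨅ (U : Finset (FlowVertex nbar u T)) (_ : FlowVertex.source ∈ U)
    (_ : FlowVertex.collector ∉ U), ∑ a ∈ U, ∑ b ∈ Uᶜ, flowCapacity α β h K a b

/-- The maximum possible file size `B*`: the least min-cut over all information flow graphs (any
finite sequence of repairs) and all data collectors connecting to `k` nodes. -/
noncomputable def maxFileSize (nbar u k dbar l : ℕ) (α β : ℝ) : ℝ≥0∞ :=
  ⨅ (T : ℕ) (h : Fin T → RackRepair nbar u dbar l) (K : Finset (RackNode nbar u))
    (_ : K.card = k), flowMinCut α β h K

/-- `(α, β)` lies on the tradeoff curve for files of size `B`, i.e. these are the parameters of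
MET-RRCs: the file size `B` attains the maximum `B*`; and, in case the repair of a node uses data
from outside its rack (`0 < dbar`), the `l + 1` nodes that can be recovered from the data used in a
repair (the replacement and its `l` local helpers, thus any `l + 1` nodes of one rack) hold
`(l + 1) α` symbols of information about the file. -/
def IsMETRRC (nbar u k dbar l : ℕ) (B α β : ℝ) : Prop :=
  0 ≤ α ∧ 0 ≤ β ∧ ENNReal.ofReal B = maxFileSize nbar u k dbar l α β ∧
    (0 < dbar → ∀ (T : ℕ) (h : Fin T → RackRepair nbar u dbar l) (K : Finset (RackNode nbar u))
      (e : Fin nbar), (∀ x ∈ K, x.1 = e) → K.card = l + 1 →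
        ENNReal.ofReal (((l : ℝ) + 1) * α) ≤ flowMinCut α β h K)

/-- The minimum storage point: first the storage `α`, then the repair bandwidth is minimized.
(For `dbar = 0` the bandwidth vanishes for every `β`, and `β` itself is minimized.) -/
def IsMETMSRR (nbar u k dbar l : ℕ) (B α β : ℝ) : Prop :=
  IsMETRRC nbar u k dbar l B α β ∧
    ∀ α' β' : ℝ, IsMETRRC nbar u k dbar l B α' β' → α < α' ∨ (α = α' ∧ β ≤ β')

/-- The minimum bandwidth point: first the repair bandwidth `dbar * β`, then the storage `α` is
minimized. -/
def IsMETMBRR (nbar u k dbar l : ℕ) (B α β : ℝ) : Prop :=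
  IsMETRRC nbar u k dbar l B α β ∧
    ∀ α' β' : ℝ, IsMETRRC nbar u k dbar l B α' β' →
      dbar * β < dbar * β' ∨ (dbar * β = dbar * β' ∧ α ≤ α')

/-!
Let the sink nodes of a cut be the current nodes on the collector side, let `x` of them be among
the first `l` sink nodes of their rack and `y` not, and give them the potential
`x * a + ∑ j < y, min a ((dbar - j / (u - l)) * b)` with `a = ofReal α` and `b = ofReal β`. A repair
increases this potential by no more than what the cut pays for it: the new sink node costs `a` if it
is cut off at its storage; otherwise its local helpers are sink nodes, so it is a surplus node of
its rack, and at most `y / (u - l)` of its helper racks consist of sink nodes, because each of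
those holds `u - l` surplus nodes. Hence the potential bounds every min-cut from below. The bound is
attained by repairing the first `k` nodes rack by rack, always with the earliest helpers, so that
`B*(α, β) = A α + (u - l) ∑ i ≤ dbar, min α (i β)` with `A = kbar l + min u₀ l`, and the information
condition on `l + 1` nodes of a rack becomes `α ≤ dbar β`.

Bounding every term of the sum by `α` gives `B* ≤ (A + (u - l) dbar) α`, strictly if `β < α`, and
bounding the `i`-th term by `i β` gives `B* ≤ (A + (u - l) (dbar + 1) / 2) dbar β` where
`α ≤ dbar β`, strictly if `α < dbar β`. The two points are the cases of equality.
-/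

open scoped Finset

theorem FlowVertex.sum_univ {nbar u T : ℕ} {M : Type*} [AddCommMonoid M]
    (f : FlowVertex nbar u T → M) :
    ∑ v, f v = f .source + (∑ x, f (.origIn x) + (∑ t, f (.newIn t) +
      (∑ i, ∑ x, f (.out i x) + (∑ t, ∑ e, f (.relay t e) + f .collector)))) := by
  -- `proxyTypeEquiv` is generated by the `deriving Fintype` clause of `FlowVertex`
  rw [← (FlowVertex.proxyTypeEquiv nbar u T).sum_comp]
  simp only [Fintype.sum_sum_type, Finset.univ_unique, Fintype.sum_sigma, Finset.sum_singleton]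
  rfl

section FiniteCuts

variable {nbar u dbar l T : ℕ}

/-- The nodes on the collector side of the cut `U` after `i` repairs. -/
def sinkNodes (U : Finset (FlowVertex nbar u T)) (i : Fin (T + 1)) : Finset (RackNode nbar u) :=
  {x | .out i x ∉ U}

theorem mem_sinkNodes {U : Finset (FlowVertex nbar u T)} {i : Fin (T + 1)} {x : RackNode nbar u} :
    x ∈ sinkNodes U i ↔ .out i x ∉ U := by
  simp [sinkNodes]

/-- A cut, given by its source side `U`, that no edge of infinite capacity crosses; the fields
after the second one are these edges, kind by kind. -/
structure IsFiniteCut (h : Fin T → RackRepair nbar u dbar l) (K : Finset (RackNode nbar u))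
    (U : Finset (FlowVertex nbar u T)) : Prop where
  source_mem : .source ∈ U
  collector_notMem : .collector ∉ U
  origIn_mem (x : RackNode nbar u) : .origIn x ∈ U
  out_succ_mem {t : Fin T} {x : RackNode nbar u} :
    .out t.castSucc x ∈ U → x ≠ (h t).failed → .out t.succ x ∈ U
  newIn_mem {t : Fin T} {x : RackNode nbar u} : .out t.castSucc x ∈ U →
    x.1 = (h t).failed.1 → x.2 ∈ (h t).localHelpers → .newIn t ∈ U
  relay_mem {t : Fin T} {x : RackNode nbar u} :
    .out t.castSucc x ∈ U → x.1 ∈ (h t).helperRacks → .relay t x.1 ∈ U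
  notMem_of_out_last_mem {x : RackNode nbar u} : .out (Fin.last T) x ∈ U → x ∉ K

/-- The capacity of a finite cut, when nodes store `a` and helper racks upload `b` symbols. -/
noncomputable def cutValue (a b : ℝ≥0∞) (h : Fin T → RackRepair nbar u dbar l)
    (U : Finset (FlowVertex nbar u T)) : ℝ≥0∞ :=
  #(sinkNodes U 0) * a + ∑ t, if .newIn t ∈ U then
    if .out t.succ (h t).failed ∈ U then 0 else a
  else #{e ∈ (h t).helperRacks | .relay t e ∈ U} * b

variable {α β : ℝ} {h : Fin T → RackRepair nbar u dbar l} {K : Finset (RackNode nbar u)}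
  {U : Finset (FlowVertex nbar u T)}

theorem flowCapacity_origIn (x : RackNode nbar u) (v : FlowVertex nbar u T) :
    flowCapacity α β h K (.origIn x) v = if v = .out 0 x then ENNReal.ofReal α else 0 := by
  cases v <;> simp [flowCapacity]

theorem flowCapacity_newIn (t : Fin T) (v : FlowVertex nbar u T) :
    flowCapacity α β h K (.newIn t) v =
      if v = .out t.succ (h t).failed then ENNReal.ofReal α else 0 := by
  cases v <;> simp [flowCapacity]

theorem flowCapacity_relay (t : Fin T) (e : Fin nbar) (v : FlowVertex nbar u T) :
    flowCapacity α β h K (.relay t e) v =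
      if v = .newIn t then if e ∈ (h t).helperRacks then ENNReal.ofReal β else 0 else 0 := by
  cases v <;> simp [flowCapacity, ite_and, eq_comm]

theorem isFiniteCut_of_flowCapacity_ne_top (hs : .source ∈ U) (hc : .collector ∉ U)
    (hU : ∀ v ∈ U, ∀ w ∉ U, flowCapacity α β h K v w ≠ ⊤) : IsFiniteCut h K U where
  source_mem := hs
  collector_notMem := hc
  origIn_mem _ := by_contra fun hx => hU _ hs _ hx rfl
  out_succ_mem hx hne := by_contra fun hx' => hU _ hx _ hx' (if_pos ⟨_, rfl, rfl, rfl, hne⟩)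
  newIn_mem hx he hg := by_contra fun ht => hU _ hx _ ht (if_pos ⟨rfl, he, hg⟩)
  relay_mem hx he := by_contra fun ht => hU _ hx _ ht (if_pos ⟨rfl, rfl, he⟩)
  notMem_of_out_last_mem hx hK := hU _ hx _ hc (if_pos ⟨rfl, hK⟩)

namespace IsFiniteCut

theorem sum_flowCapacity_source (hU : IsFiniteCut h K U) :
    ∑ w ∈ Uᶜ, flowCapacity α β h K .source w = 0 := by
  refine Finset.sum_eq_zero fun w hw => ?_
  cases w
  case origIn x => exact absurd (hU.origIn_mem x) (Finset.mem_compl.1 hw)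
  all_goals rfl

theorem sum_flowCapacity_out (hU : IsFiniteCut h K U) {i : Fin (T + 1)} {x : RackNode nbar u}
    (hx : .out i x ∈ U) : ∑ w ∈ Uᶜ, flowCapacity α β h K (.out i x) w = 0 := by
  refine Finset.sum_eq_zero fun w hw => ?_
  rw [Finset.mem_compl] at hw
  cases w
  case source | origIn => rfl
  case newIn t => exact if_neg fun ⟨hi, he, hg⟩ => hw (hU.newIn_mem (hi ▸ hx) he hg)
  case out j y =>
    refine if_neg ?_
    rintro ⟨t, rfl, rfl, rfl, hne⟩
    exact hw (hU.out_succ_mem hx hne)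
  case relay t e =>
    refine if_neg ?_
    rintro ⟨rfl, rfl, he⟩
    exact hw (hU.relay_mem hx he)
  case collector => exact if_neg fun ⟨hi, hK⟩ => hU.notMem_of_out_last_mem (hi ▸ hx) hK

theorem sum_flowCapacity (hU : IsFiniteCut h K U) :
    ∑ v ∈ U, ∑ w ∈ Uᶜ, flowCapacity α β h K v w =
      cutValue (ENNReal.ofReal α) (ENNReal.ofReal β) h U := by
  have hout : ∀ i x,
      (if .out i x ∈ U then ∑ w ∈ Uᶜ, flowCapacity α β h K (.out i x) w else 0) = 0 := fun _ _ =>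
    ite_eq_right_iff.2 hU.sum_flowCapacity_out
  rw [← Finset.univ_inter U, ← Finset.sum_ite_mem, Finset.univ_inter, FlowVertex.sum_univ]
  simp only [hU.sum_flowCapacity_source, hout, hU.collector_notMem, hU.origIn_mem,
    flowCapacity_origIn, flowCapacity_newIn, flowCapacity_relay, Finset.sum_ite_eq',
    Finset.mem_compl, if_true, if_false, ite_self, Finset.sum_const_zero, zero_add, add_zero]
  rw [cutValue, ← Finset.sum_add_distrib, ← nsmul_eq_mul, ← Finset.sum_const, sinkNodes,
    Finset.sum_filter]
  refine congrArg _ (Finset.sum_congr rfl fun t _ => ?_)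
  rw [← nsmul_eq_mul, ← Finset.sum_const, Finset.sum_filter]
  by_cases ht : .newIn t ∈ U
  · simp [ht]
  · simp only [ht, if_false, not_false_eq_true, if_true, zero_add]
    rw [← Finset.sum_ite_mem_eq (h t).helperRacks]
    exact Finset.sum_congr rfl fun e _ => by split_ifs <;> rfl

end IsFiniteCut

theorem flowMinCut_eq_iInf_cutValue (α β : ℝ) (h : Fin T → RackRepair nbar u dbar l)
    (K : Finset (RackNode nbar u)) :
    flowMinCut α β h K =
      ⨅ (U) (_ : IsFiniteCut h K U), cutValue (ENNReal.ofReal α) (ENNReal.ofReal β) h U := by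
  refine le_antisymm (le_iInf₂ fun U hU => ?_) (le_iInf₂ fun U hs => le_iInf fun hc => ?_)
  · rw [← hU.sum_flowCapacity]
    exact iInf₂_le_of_le U hU.source_mem (iInf_le _ hU.collector_notMem)
  · by_cases hfin : ∀ v ∈ U, ∀ w ∉ U, flowCapacity α β h K v w ≠ ⊤
    · have hU := isFiniteCut_of_flowCapacity_ne_top hs hc hfin
      exact (iInf₂_le U hU).trans_eq hU.sum_flowCapacity.symm
    · push Not at hfin
      obtain ⟨v, hv, w, hw, htop⟩ := hfin
      refine le_top.trans_eq (Eq.symm (ENNReal.sum_eq_top.2 ⟨v, hv, ?_⟩))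
      exact ENNReal.sum_eq_top.2 ⟨w, Finset.mem_compl.2 hw, htop⟩

end FiniteCuts

/-- The number of those among `k` nodes, filling the racks of `u` nodes one after the other, that
are among the first `l` nodes of their rack. -/
def baseCount (u l k : ℕ) : ℕ := k / u * l + min (k % u) l

/-- The number of those among `k` nodes, filling the racks of `u` nodes one after the other, that
are not among the first `l` nodes of their rack. -/
def excessCount (u l k : ℕ) : ℕ := k / u * (u - l) + (k % u - l)

section Counts

variable {u l : ℕ}

theorem baseCount_add_excessCount (hl : l ≤ u) (k : ℕ) :
    baseCount u l k + excessCount u l k = k := by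
  have hk := Nat.div_add_mod' k u
  have hsplit : k / u * l + k / u * (u - l) = k / u * u := by rw [← mul_add, Nat.add_sub_cancel' hl]
  unfold baseCount excessCount
  omega

theorem baseCount_pos (hl : 1 ≤ l) {k : ℕ} (hk : 0 < k) : 0 < baseCount u l k := by
  rcases (k / u).eq_zero_or_pos with hdiv | hdiv
  · have hmod : k % u = k := by simpa [hdiv] using Nat.div_add_mod k u
    exact Nat.add_pos_right _ (lt_min (hk.trans_eq hmod.symm) hl)
  · exact Nat.add_pos_left (Nat.mul_pos hdiv hl) _

theorem excessCount_of_le (hl : l < u) {k : ℕ} (hk : k ≤ u) : excessCount u l k = k - l := by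
  unfold excessCount
  rcases hk.lt_or_eq with h | rfl
  · simp [Nat.div_eq_of_lt h, Nat.mod_eq_of_lt h]
  · simp [Nat.div_self (Nat.zero_lt_of_lt hl)]

theorem excessCount_succ (hl : l < u) (k : ℕ) :
    excessCount u l (k + 1) = excessCount u l k + if k % u < l then 0 else 1 := by
  have hu : 0 < u := by omega
  have hlt := Nat.mod_lt k hu
  have hk := Nat.div_add_mod k u
  unfold excessCount
  rcases (show k % u + 1 ≤ u from hlt).lt_or_eq with h | h
  · obtain ⟨hdiv, hmod⟩ := (Nat.div_mod_unique hu).2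
      ⟨show k % u + 1 + u * (k / u) = k + 1 by omega, h⟩
    rw [hdiv, hmod]
    split_ifs <;> omega
  · obtain ⟨hdiv, hmod⟩ := (Nat.div_mod_unique hu).2
      ⟨show 0 + u * (k / u + 1) = k + 1 by rw [mul_add]; omega, hu⟩
    rw [hdiv, hmod, add_mul]
    split_ifs <;> omega

theorem baseCount_succ (hl : l < u) (k : ℕ) :
    baseCount u l (k + 1) = baseCount u l k + if k % u < l then 1 else 0 := by
  have h := baseCount_add_excessCount hl.le k
  have h' := baseCount_add_excessCount hl.le (k + 1)
  rw [excessCount_succ hl] at h'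
  split_ifs at h' ⊢ <;> omega

theorem excessCount_div (hl : l < u) (k : ℕ) : excessCount u l k / (u - l) = k / u := by
  have hlt := Nat.mod_lt k (Nat.zero_lt_of_lt hl)
  unfold excessCount
  rw [mul_comm, Nat.mul_add_div (by omega), Nat.div_eq_of_lt (show k % u - l < u - l by omega),
    add_zero]

theorem excessCount_add_le (hl : l < u) (x y : ℕ) :
    excessCount u l x + excessCount u l y ≤ excessCount u l (x + y) := by
  have hu : 0 < u := by omega
  have hx := Nat.mod_lt x hu
  have hy := Nat.mod_lt y hu
  unfold excessCount
  rw [Nat.add_div hu, Nat.add_mod x y]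
  split_ifs with hc
  · rw [Nat.mod_eq_sub_mod hc, Nat.mod_eq_of_lt (show x % u + y % u - u < u by omega), add_mul,
      add_mul]
    omega
  · rw [Nat.mod_eq_of_lt (show x % u + y % u < u by omega), add_mul, add_mul]
    omega

theorem sum_sub_le_excessCount {ι : Type*} (hl : l < u) (s : Finset ι) (c : ι → ℕ)
    (hc : ∀ i ∈ s, c i ≤ u) : ∑ i ∈ s, (c i - l) ≤ excessCount u l (∑ i ∈ s, c i) := by
  classical
  induction s using Finset.induction_on with
  | empty => simp
  | insert i s hi ih =>
    rw [Finset.sum_insert hi, Finset.sum_insert hi,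
      ← excessCount_of_le hl (hc i (Finset.mem_insert_self i s))]
    exact (Nat.add_le_add_left (ih fun j hj => hc j (Finset.mem_insert_of_mem hj)) _).trans
      (excessCount_add_le hl _ _)

end Counts

/-- The least contribution to a cut of a node whose local helpers are on the collector side: its
storage `a`, or the upload `b` of each of its `d` helper racks but the `i` ones that lie entirely
on the collector side. -/
noncomputable def nodeCost (d : ℕ) (a b : ℝ≥0∞) (i : ℕ) : ℝ≥0∞ := min a ((d - i : ℕ) * b)

/-- The cost of `x` nodes cut at their storage and of `y` further nodes repaired one after the
other, `m` in each rack, so that `j / m` racks are complete before the `j`-th of these repairs. -/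
noncomputable def cutCost (d m : ℕ) (a b : ℝ≥0∞) (x y : ℕ) : ℝ≥0∞ :=
  x * a + ∑ j ∈ Finset.range y, nodeCost d a b (j / m)

section CutCost

variable (d m : ℕ) (a b : ℝ≥0∞) {x x' y y' : ℕ}

theorem cutCost_mono (hx : x ≤ x') (hy : y ≤ y') : cutCost d m a b x y ≤ cutCost d m a b x' y' :=
  add_le_add (mul_le_mul_left (Nat.cast_le.2 hx) _)
    (Finset.sum_le_sum_of_subset (Finset.range_subset_range.2 hy))

theorem cutCost_succ_left (x y : ℕ) : cutCost d m a b (x + 1) y = cutCost d m a b x y + a := by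
  rw [cutCost, cutCost, Nat.cast_succ, add_mul, one_mul, add_right_comm]

theorem cutCost_succ_right (x y : ℕ) :
    cutCost d m a b x (y + 1) = cutCost d m a b x y + nodeCost d a b (y / m) := by
  rw [cutCost, cutCost, Finset.sum_range_succ, add_assoc]

theorem cutCost_add_right_le (x y j : ℕ) :
    cutCost d m a b x (y + j) ≤ cutCost d m a b (x + j) y := by
  induction j with
  | zero => rfl
  | succ j ih =>
    rw [← add_assoc, ← add_assoc, cutCost_succ_right, cutCost_succ_left]
    exact add_le_add ih (min_le_left _ _)

theorem cutCost_baseCount_excessCount {u l : ℕ} (hl : l < u) (k : ℕ) :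
    cutCost d (u - l) a b (baseCount u l k) (excessCount u l k) =
      ∑ t ∈ Finset.range k, if t % u < l then a else nodeCost d a b (t / u) := by
  induction k with
  | zero => simp [cutCost, baseCount, excessCount]
  | succ k ih =>
    rw [Finset.sum_range_succ, ← ih, baseCount_succ hl, excessCount_succ hl]
    split_ifs
    · rw [add_zero, cutCost_succ_left]
    · rw [add_zero, cutCost_succ_right, excessCount_div hl]

end CutCost

section Racks

variable {nbar u : ℕ}

/-- The number of nodes of `S` in the rack `e`. -/
def rackCount (S : Finset (RackNode nbar u)) (e : Fin nbar) : ℕ := #{x ∈ S | x.1 = e}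

/-- The number of nodes of `S`, counting at most `l` in each rack. -/
def coreCount (l : ℕ) (S : Finset (RackNode nbar u)) : ℕ := ∑ e, min (rackCount S e) l

/-- The number of nodes of `S`, not counting the first `l` in each rack. -/
def surplusCount (l : ℕ) (S : Finset (RackNode nbar u)) : ℕ := ∑ e, (rackCount S e - l)

theorem rackCount_mono (e : Fin nbar) : Monotone (rackCount (u := u) · e) := fun _ _ h =>
  Finset.card_le_card (Finset.filter_subset_filter _ h)

theorem rackCount_insert {S : Finset (RackNode nbar u)} {x : RackNode nbar u} (hx : x ∉ S)
    (e : Fin nbar) : rackCount (insert x S) e = rackCount S e + if x.1 = e then 1 else 0 := by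
  unfold rackCount
  rw [Finset.filter_insert]
  split_ifs
  · rw [Finset.card_insert_of_notMem (by simp [hx])]
  · rfl

theorem rackCount_univ (e : Fin nbar) :
    rackCount (Finset.univ : Finset (RackNode nbar u)) e = u := by
  have : ({x | x.1 = e} : Finset (RackNode nbar u)) = {e} ×ˢ Finset.univ := by
    ext ⟨e', g⟩
    simp [eq_comm]
  rw [rackCount, this, Finset.card_product, Finset.card_singleton, one_mul, Finset.card_fin]

theorem rackCount_le (S : Finset (RackNode nbar u)) (e : Fin nbar) : rackCount S e ≤ u :=
  (rackCount_mono e (Finset.subset_univ S)).trans_eq (rackCount_univ e)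

theorem rackCount_eq_of_forall_mem {S : Finset (RackNode nbar u)} {e : Fin nbar}
    (he : ∀ g, (e, g) ∈ S) : rackCount S e = u := by
  refine (rackCount_le S e).antisymm ((rackCount_univ e).symm.trans_le (Finset.card_le_card ?_))
  rintro ⟨_, g⟩ hx
  obtain rfl := (Finset.mem_filter.1 hx).2
  exact Finset.mem_filter.2 ⟨he g, rfl⟩

theorem card_le_rackCount {S : Finset (RackNode nbar u)} {e : Fin nbar} {L : Finset (Fin u)}
    (hL : ∀ g ∈ L, (e, g) ∈ S) : #L ≤ rackCount S e :=
  Finset.card_le_card_of_injOn (Prod.mk e) (fun g hg => by simpa using hL g hg) (by simp)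

theorem sum_rackCount (S : Finset (RackNode nbar u)) : ∑ e, rackCount S e = #S :=
  (Finset.card_eq_sum_card_fiberwise (f := Prod.fst) (t := Finset.univ) (by simp)).symm

theorem coreCount_add_surplusCount (l : ℕ) (S : Finset (RackNode nbar u)) :
    coreCount l S + surplusCount l S = #S := by
  rw [← sum_rackCount, coreCount, surplusCount, ← Finset.sum_add_distrib]
  exact Finset.sum_congr rfl fun e _ => by omega

theorem coreCount_mono (l : ℕ) : Monotone (coreCount (nbar := nbar) (u := u) l) := fun _ _ h =>
  Finset.sum_le_sum fun e _ => min_le_min_right _ (rackCount_mono e h)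

theorem surplusCount_mono (l : ℕ) : Monotone (surplusCount (nbar := nbar) (u := u) l) :=
  fun _ _ h => Finset.sum_le_sum fun e _ => Nat.sub_le_sub_right (rackCount_mono e h) _

theorem surplusCount_le_excessCount {l : ℕ} (hl : l < u) (S : Finset (RackNode nbar u)) :
    surplusCount l S ≤ excessCount u l #S := by
  rw [← sum_rackCount]
  exact sum_sub_le_excessCount hl _ _ fun e _ => rackCount_le S e

theorem surplusCount_insert (l : ℕ) {S : Finset (RackNode nbar u)} {x : RackNode nbar u}
    (hx : x ∉ S) :
    surplusCount l (insert x S) = surplusCount l S + if l ≤ rackCount S x.1 then 1 else 0 := by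
  have hrack : ∀ e, rackCount (insert x S) e - l =
      (rackCount S e - l) + if x.1 = e then if l ≤ rackCount S x.1 then 1 else 0 else 0 := by
    intro e
    rw [rackCount_insert hx]
    split_ifs <;> grind
  simp [surplusCount, hrack, Finset.sum_add_distrib]

theorem coreCount_insert (l : ℕ) {S : Finset (RackNode nbar u)} {x : RackNode nbar u}
    (hx : x ∉ S) :
    coreCount l (insert x S) = coreCount l S + if l ≤ rackCount S x.1 then 0 else 1 := by
  have h := coreCount_add_surplusCount l S
  have h' := coreCount_add_surplusCount l (insert x S)
  rw [surplusCount_insert l hx, Finset.card_insert_of_notMem hx] at h'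
  split_ifs at h' ⊢ <;> omega

theorem card_fullRacks_mul_le (l : ℕ) (S : Finset (RackNode nbar u)) :
    #{e : Fin nbar | ∀ g, (e, g) ∈ S} * (u - l) ≤ surplusCount l S := by
  rw [← smul_eq_mul, ← Finset.sum_const]
  refine (Finset.sum_le_sum fun e he => ?_).trans
    (Finset.sum_le_sum_of_subset (Finset.subset_univ _))
  rw [rackCount_eq_of_forall_mem (Finset.mem_filter.1 he).2]

end Racks

/-- The potential that bounds the value of a cut from below, as a function of the nodes on the
collector side. -/
noncomputable def setCost {nbar u : ℕ} (d l : ℕ) (a b : ℝ≥0∞) (S : Finset (RackNode nbar u)) :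
    ℝ≥0∞ :=
  cutCost d (u - l) a b (coreCount l S) (surplusCount l S)

section SetCost

variable {nbar u l : ℕ} (d : ℕ) (a b : ℝ≥0∞) (S : Finset (RackNode nbar u))

theorem setCost_mono (l : ℕ) : Monotone (setCost (nbar := nbar) (u := u) d l a b) := fun _ _ h =>
  cutCost_mono _ _ _ _ (coreCount_mono l h) (surplusCount_mono l h)

theorem setCost_le_card_mul (l : ℕ) : setCost d l a b S ≤ #S * a := by
  have h := cutCost_add_right_le d (u - l) a b (coreCount l S) 0 (surplusCount l S)
  rw [zero_add, coreCount_add_surplusCount] at h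
  exact h.trans_eq (by simp [cutCost])

theorem setCost_insert_le (l : ℕ) (x : RackNode nbar u) :
    setCost d l a b (insert x S) ≤ setCost d l a b S + a := by
  by_cases hx : x ∈ S
  · rw [Finset.insert_eq_of_mem hx]
    exact le_self_add
  · rw [setCost, coreCount_insert l hx, surplusCount_insert l hx]
    split_ifs
    · rw [cutCost_succ_right]
      exact add_le_add_right (min_le_left _ _) _
    · exact (cutCost_succ_left ..).le

/-- Every full rack holds `u - l` surplus nodes, hence at most `surplusCount l S / (u - l)` of the
helper racks are full. -/
theorem setCost_insert_le_of_helpers (hl : l < u) {x : RackNode nbar u}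
    (hx : l ≤ rackCount S x.1) (H : Finset (Fin nbar)) :
    setCost #H l a b (insert x S) ≤ setCost #H l a b S + #{e ∈ H | ¬ ∀ g, (e, g) ∈ S} * b := by
  by_cases hxS : x ∈ S
  · rw [Finset.insert_eq_of_mem hxS]
    exact le_self_add
  · rw [setCost, coreCount_insert l hxS, surplusCount_insert l hxS, if_pos hx, if_pos hx, add_zero,
      cutCost_succ_right]
    have hfull : #{e ∈ H | ∀ g, (e, g) ∈ S} ≤ surplusCount l S / (u - l) :=
      (Finset.card_le_card (Finset.filter_subset_filter _ (Finset.subset_univ _))).trans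
        ((Nat.le_div_iff_mul_le (Nat.sub_pos_of_lt hl)).2 (card_fullRacks_mul_le l S))
    have hsplit := Finset.card_filter_add_card_filter_not (s := H) (fun e => ∀ g, (e, g) ∈ S)
    refine add_le_add_right ((min_le_right _ _).trans ?_) _
    gcongr
    omega

theorem cutCost_le_setCost (hl : l < u) :
    cutCost d (u - l) a b (baseCount u l #S) (excessCount u l #S) ≤ setCost d l a b S := by
  have hcard := coreCount_add_surplusCount l S
  have hcard' := baseCount_add_excessCount hl.le #S
  obtain ⟨j, hj⟩ := Nat.exists_eq_add_of_le (surplusCount_le_excessCount hl S)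
  rw [hj, setCost, show coreCount l S = baseCount u l #S + j by omega]
  exact cutCost_add_right_le ..

end SetCost

section LowerBound

variable {nbar u dbar l T : ℕ} {h : Fin T → RackRepair nbar u dbar l}
  {K : Finset (RackNode nbar u)} {U : Finset (FlowVertex nbar u T)}

theorem apply_last_le_add_sum {M : Type*} [AddCommMonoid M] [PartialOrder M] [IsOrderedAddMonoid M]
    {n : ℕ} (φ : Fin (n + 1) → M) (c : Fin n → M) (h : ∀ t, φ t.succ ≤ φ t.castSucc + c t) :
    φ (Fin.last n) ≤ φ 0 + ∑ t, c t := by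
  induction n with
  | zero => simp
  | succ n ih =>
    rw [Fin.sum_univ_castSucc, ← add_assoc]
    refine (h (Fin.last n)).trans (add_le_add_left ?_ _)
    exact ih (fun i => φ i.castSucc) (fun t => c t.castSucc) fun t => h t.castSucc

namespace IsFiniteCut

theorem subset_sinkNodes_last (hU : IsFiniteCut h K U) : K ⊆ sinkNodes U (Fin.last T) :=
  fun _ hx => mem_sinkNodes.2 fun hx' => hU.notMem_of_out_last_mem hx' hx

theorem sinkNodes_succ_subset (hU : IsFiniteCut h K U) (t : Fin T) :
    sinkNodes U t.succ ⊆ insert (h t).failed (sinkNodes U t.castSucc) := by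
  intro x hx
  rw [Finset.mem_insert, or_iff_not_imp_left, mem_sinkNodes]
  exact fun hne hx' => mem_sinkNodes.1 hx (hU.out_succ_mem hx' hne)

theorem le_rackCount_sinkNodes (hU : IsFiniteCut h K U) {t : Fin T} (ht : .newIn t ∉ U) :
    l ≤ rackCount (sinkNodes U t.castSucc) (h t).failed.1 :=
  (h t).card_localHelpers.symm.trans_le <| card_le_rackCount fun _ hg =>
    mem_sinkNodes.2 fun hx => ht (hU.newIn_mem hx rfl hg)

theorem setCost_sinkNodes_succ_le (hU : IsFiniteCut h K U) (hl : l < u) (a b : ℝ≥0∞) (t : Fin T) :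
    setCost dbar l a b (sinkNodes U t.succ) ≤ setCost dbar l a b (sinkNodes U t.castSucc) +
      if .newIn t ∈ U then
        if .out t.succ (h t).failed ∈ U then 0 else a
      else #{e ∈ (h t).helperRacks | .relay t e ∈ U} * b := by
  have hsub := hU.sinkNodes_succ_subset t
  split_ifs with hnew hfailed
  · rw [add_zero]
    refine setCost_mono _ _ _ _ ((Finset.subset_insert_iff_of_notMem ?_).1 hsub)
    exact fun hx => mem_sinkNodes.1 hx hfailed
  · exact (setCost_mono _ _ _ _ hsub).trans (setCost_insert_le ..)
  · have hle := setCost_insert_le_of_helpers a b (sinkNodes U t.castSucc) hl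
      (hU.le_rackCount_sinkNodes hnew) (h t).helperRacks
    rw [(h t).card_helperRacks] at hle
    refine (setCost_mono _ _ _ _ hsub).trans (hle.trans ?_)
    gcongr with e he
    intro hrack
    by_contra hrelay
    exact hrack fun g => mem_sinkNodes.2 fun hx => hrelay (hU.relay_mem hx he)

theorem setCost_le_cutValue (hU : IsFiniteCut h K U) (hl : l < u) (a b : ℝ≥0∞) :
    setCost dbar l a b K ≤ cutValue a b h U := calc
  _ ≤ setCost dbar l a b (sinkNodes U (Fin.last T)) :=
    setCost_mono _ _ _ _ hU.subset_sinkNodes_last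
  _ ≤ setCost dbar l a b (sinkNodes U 0) + _ :=
    apply_last_le_add_sum (fun i => setCost dbar l a b (sinkNodes U i)) _
      (hU.setCost_sinkNodes_succ_le hl a b)
  _ ≤ cutValue a b h U := add_le_add_left (setCost_le_card_mul ..) _

end IsFiniteCut

theorem cutCost_le_flowMinCut (hl : l < u) (α β : ℝ) (h : Fin T → RackRepair nbar u dbar l)
    (K : Finset (RackNode nbar u)) :
    cutCost dbar (u - l) (ENNReal.ofReal α) (ENNReal.ofReal β) (baseCount u l #K)
      (excessCount u l #K) ≤ flowMinCut α β h K := by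
  rw [flowMinCut_eq_iInf_cutValue]
  exact le_iInf₂ fun U hU => (cutCost_le_setCost _ _ _ _ hl).trans (hU.setCost_le_cutValue hl _ _)

end LowerBound

section UpperBound

variable {nbar u dbar l k : ℕ}

theorem exists_card_filter_not_lt_eq {n d : ℕ} (hd : d < n) (i : Fin n) :
    ∃ H : Finset (Fin n), #H = d ∧ i ∉ H ∧ #{j ∈ H | ¬ j < i} = d - i := by
  rcases le_total (i : ℕ) d with h | h
  · obtain ⟨H, hsub, hH, hcard⟩ := Finset.exists_subsuperset_card_eq (s := Finset.Iio i) (t := {i}ᶜ)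
      (n := d) (fun j hj => by simpa using (Finset.mem_Iio.1 hj).ne) (by simpa using h)
      (by rw [Finset.card_compl, Finset.card_singleton, Fintype.card_fin]; omega)
    refine ⟨H, hcard, fun hi => by simpa using hH hi, ?_⟩
    have hlt : {j ∈ H | j < i} = Finset.Iio i := by
      ext j
      simpa using fun hj => hsub (Finset.mem_Iio.2 hj)
    have hsplit := Finset.card_filter_add_card_filter_not (s := H) (· < i)
    rw [hlt, Fin.card_Iio] at hsplit
    omega
  · obtain ⟨H, hsub, hcard⟩ :=
      Finset.exists_subset_card_eq (s := Finset.Iio i) (n := d) (by simpa using h)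
    refine ⟨H, hcard, fun hi => by simpa using hsub hi, ?_⟩
    rw [Nat.sub_eq_zero_of_le h, Finset.card_eq_zero, Finset.filter_eq_empty_iff]
    exact fun j hj => not_not.2 (Finset.mem_Iio.1 (hsub hj))

/-- The first `k` nodes, rack by rack. -/
def firstNodes (nbar u k : ℕ) : Finset (RackNode nbar u) := {x | (finProdFinEquiv x : ℕ) < k}

theorem card_firstNodes (hk : k ≤ nbar * u) : #(firstNodes nbar u k) = k := by
  have hmap : (firstNodes nbar u k).map finProdFinEquiv.toEmbedding =
      ({i | (i : ℕ) < k} : Finset (Fin (nbar * u))) := by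
    ext i
    simp [firstNodes, Finset.mem_map_equiv, Nat.mod_add_div]
  rw [← Finset.card_map finProdFinEquiv.toEmbedding, hmap, Fin.card_filter_val_lt, min_eq_right hk]

/-- Repairs of the first `k` nodes, rack by rack, that connect to as many earlier nodes of the host
rack and to as many earlier racks as possible. -/
structure IsSequential (h : Fin k → RackRepair nbar u dbar l) : Prop where
  index_failed (t : Fin k) : (finProdFinEquiv (h t).failed : ℕ) = t
  card_localHelpers_not_lt (t : Fin k) :
    #{g ∈ (h t).localHelpers | ¬ g < (h t).failed.2} = l - (h t).failed.2
  card_helperRacks_not_lt (t : Fin k) :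
    #{e ∈ (h t).helperRacks | ¬ e < (h t).failed.1} = dbar - (h t).failed.1

theorem exists_isSequential (hl : l < u) (hk : k ≤ nbar * u) (hd : dbar < nbar) :
    ∃ h : Fin k → RackRepair nbar u dbar l, IsSequential h := by
  choose L hLcard hL hLlt using fun g : Fin u => exists_card_filter_not_lt_eq hl g
  choose H hHcard hH hHlt using fun e : Fin nbar => exists_card_filter_not_lt_eq hd e
  let node (t : Fin k) : RackNode nbar u := finProdFinEquiv.symm (Fin.castLE hk t)
  exact ⟨fun t => ⟨node t, L (node t).2, hLcard _, hL _, H (node t).1, hHcard _, hH _⟩,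
    fun t => by simp [node, Nat.mod_add_div], fun t => hLlt _, fun t => hHlt _⟩

open Classical in
/-- The cut in which, after `t` of the sequential repairs `h`, exactly the first `t` nodes are on
the collector side, and each replacement is cut where this is cheaper: at its storage `a`, or at
the uploads `b` of its helper racks. -/
noncomputable def sequentialCut (a b : ℝ≥0∞) (h : Fin k → RackRepair nbar u dbar l) :
    Finset (FlowVertex nbar u k) :=
  Finset.univ.filter fun
    | .source => True
    | .origIn _ => True
    | .newIn t => (h t).failed.2 < l ∨ a ≤ (dbar - (h t).failed.1 : ℕ) * b
    | .out i x => (i : ℕ) ≤ finProdFinEquiv x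
    | .relay t e => ¬ e < (h t).failed.1
    | .collector => False

namespace IsSequential

variable {h : Fin k → RackRepair nbar u dbar l}

theorem failed_fst (hh : IsSequential h) (t : Fin k) : ((h t).failed.1 : ℕ) = t / u := by
  rw [← hh.index_failed t, finProdFinEquiv_apply_val, Nat.add_mul_div_left _ _ (h t).failed.2.pos,
    Nat.div_eq_of_lt (h t).failed.2.2, zero_add]

theorem failed_snd (hh : IsSequential h) (t : Fin k) : ((h t).failed.2 : ℕ) = t % u := by
  rw [← hh.index_failed t, finProdFinEquiv_apply_val, Nat.add_mul_mod_self_left,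
    Nat.mod_eq_of_lt (h t).failed.2.2]

theorem index_lt_of_fst_lt (hh : IsSequential h) {t : Fin k} {x : RackNode nbar u}
    (hx : x.1 < (h t).failed.1) : (finProdFinEquiv x : ℕ) < t := by
  have hmul := Nat.mul_le_mul_left u (Nat.succ_le_of_lt (Fin.lt_def.1 hx))
  rw [← hh.index_failed t, finProdFinEquiv_apply_val, finProdFinEquiv_apply_val]
  rw [Nat.mul_succ] at hmul
  omega

theorem localHelper_lt (hh : IsSequential h) {t : Fin k} (ht : l ≤ (h t).failed.2) {g : Fin u}
    (hg : g ∈ (h t).localHelpers) : g < (h t).failed.2 := by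
  have hcard := hh.card_localHelpers_not_lt t
  rw [Nat.sub_eq_zero_of_le ht, Finset.card_eq_zero, Finset.filter_eq_empty_iff] at hcard
  exact not_not.1 (hcard hg)

theorem isFiniteCut_sequentialCut (hh : IsSequential h) (a b : ℝ≥0∞) :
    IsFiniteCut h (firstNodes nbar u k) (sequentialCut a b h) where
  source_mem := by simp [sequentialCut]
  collector_notMem := by simp [sequentialCut]
  origIn_mem x := by simp [sequentialCut]
  out_succ_mem {t x} hx hne := by
    have hne' : (finProdFinEquiv x : ℕ) ≠ t := fun heq =>
      hne (finProdFinEquiv.injective (Fin.ext (heq.trans (hh.index_failed t).symm)))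
    simp only [sequentialCut, Finset.mem_filter_univ, Fin.val_castSucc, Fin.val_succ] at hx ⊢
    omega
  newIn_mem {t x} hx hrack hg := by
    simp only [sequentialCut, Finset.mem_filter_univ, Fin.val_castSucc] at hx ⊢
    refine .inl (lt_of_not_ge fun ht => hx.not_gt ?_)
    have hlt := Fin.lt_def.1 (hh.localHelper_lt ht hg)
    rw [← hh.index_failed t, finProdFinEquiv_apply_val, finProdFinEquiv_apply_val, hrack]
    exact Nat.add_lt_add_right hlt _
  relay_mem {t x} hx _ := by
    simp only [sequentialCut, Finset.mem_filter_univ, Fin.val_castSucc] at hx ⊢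
    exact fun hlt => hx.not_gt (hh.index_lt_of_fst_lt hlt)
  notMem_of_out_last_mem {x} hx := by
    simpa [sequentialCut, firstNodes] using hx

theorem cutValue_sequentialCut_le (hh : IsSequential h) (hl : l < u) (a b : ℝ≥0∞) :
    cutValue a b h (sequentialCut a b h) ≤
      cutCost dbar (u - l) a b (baseCount u l k) (excessCount u l k) := by
  have hsink : sinkNodes (sequentialCut a b h) 0 = ∅ := by simp [sinkNodes, sequentialCut]
  rw [cutValue, hsink, Finset.card_empty, Nat.cast_zero, zero_mul, zero_add,
    cutCost_baseCount_excessCount _ _ _ hl, ← Fin.sum_univ_eq_sum_range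
      (fun t => if t % u < l then a else nodeCost dbar a b (t / u))]
  refine Finset.sum_le_sum fun t _ => ?_
  rw [← hh.failed_fst, ← hh.failed_snd]
  have hnew : .newIn t ∈ sequentialCut a b h ↔
      (h t).failed.2 < l ∨ a ≤ (dbar - (h t).failed.1 : ℕ) * b := by
    simp [sequentialCut]
  by_cases ht : .newIn t ∈ sequentialCut a b h
  · have hcost : (if ((h t).failed.2 : ℕ) < l then a else nodeCost dbar a b (h t).failed.1) = a :=
      ite_eq_left_iff.2 fun hlocal => min_eq_left ((hnew.1 ht).resolve_left hlocal)
    rw [if_pos ht, hcost]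
    split_ifs
    · exact zero_le
    · exact le_rfl
  · obtain ⟨hlocal, hrack⟩ := not_or.1 (hnew.not.1 ht)
    rw [if_neg ht, if_neg hlocal, nodeCost, min_eq_right (le_of_not_ge hrack),
      ← hh.card_helperRacks_not_lt]
    simp [sequentialCut]

end IsSequential

theorem exists_flowMinCut_le (hl : l < u) (hk : k ≤ nbar * u) (hd : dbar < nbar) (α β : ℝ) :
    ∃ h : Fin k → RackRepair nbar u dbar l, flowMinCut α β h (firstNodes nbar u k) ≤
      cutCost dbar (u - l) (ENNReal.ofReal α) (ENNReal.ofReal β) (baseCount u l k)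
        (excessCount u l k) := by
  obtain ⟨h, hh⟩ := exists_isSequential hl hk hd
  refine ⟨h, ?_⟩
  rw [flowMinCut_eq_iInf_cutValue]
  exact (iInf₂_le _ (hh.isFiniteCut_sequentialCut _ _)).trans (hh.cutValue_sequentialCut_le hl _ _)

theorem maxFileSize_eq_cutCost (hl : l < u) (hk : k ≤ nbar * u) (hd : dbar < nbar) (α β : ℝ) :
    maxFileSize nbar u k dbar l α β =
      cutCost dbar (u - l) (ENNReal.ofReal α) (ENNReal.ofReal β) (baseCount u l k)
        (excessCount u l k) := by
  refine le_antisymm ?_ (le_iInf₂ fun T h => le_iInf₂ fun K hK => ?_)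
  · obtain ⟨h, hh⟩ := exists_flowMinCut_le hl hk hd α β
    exact iInf₂_le_of_le k h (iInf₂_le_of_le _ (card_firstNodes hk) hh)
  · subst hK
    exact cutCost_le_flowMinCut hl α β h K

end UpperBound

section MaxFileSize

variable {nbar u k dbar l d : ℕ} {α β : ℝ}

theorem nodeCost_ofReal (α β : ℝ) (d i : ℕ) :
    nodeCost d (ENNReal.ofReal α) (ENNReal.ofReal β) i =
      ENNReal.ofReal (min α ((d - i : ℕ) * β)) := by
  rw [nodeCost, ENNReal.ofReal_min, ENNReal.ofReal_mul (Nat.cast_nonneg _), ENNReal.ofReal_natCast]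

theorem sum_range_mul_div {M : Type*} [AddCommMonoid M] {m : ℕ} (hm : 0 < m) (f : ℕ → M) (n : ℕ) :
    ∑ j ∈ Finset.range (n * m), f (j / m) = m • ∑ i ∈ Finset.range n, f i := by
  induction n with
  | zero => simp
  | succ n ih =>
    have hblock : ∀ j ∈ Finset.range m, f ((n * m + j) / m) = f n := fun j hj => by
      rw [mul_comm, Nat.mul_add_div hm, Nat.div_eq_of_lt (Finset.mem_range.1 hj), add_zero]
    rw [add_mul, one_mul, Finset.sum_range_add, ih, Finset.sum_congr rfl hblock, Finset.sum_const,
      Finset.card_range, Finset.sum_range_succ, smul_add]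

theorem sum_range_nodeCost_div {m y : ℕ} (hm : 0 < m) (hy : d * m ≤ y) (a b : ℝ≥0∞) :
    ∑ j ∈ Finset.range y, nodeCost d a b (j / m) =
      m * ∑ i ∈ Finset.range d, nodeCost d a b i := by
  rw [← nsmul_eq_mul, ← sum_range_mul_div hm]
  refine (Finset.sum_subset (Finset.range_subset_range.2 hy) fun j _ hj => ?_).symm
  rw [Finset.mem_range, not_lt, ← Nat.le_div_iff_mul_le hm] at hj
  simp [nodeCost, Nat.sub_eq_zero_of_le hj]

/-- The maximum possible file size as a function of `(α, β)`: `A` of the `k` nodes of a collector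
contribute their storage, and `m` nodes in each of the first `d` racks contribute their storage or
the uploads of the helper racks beyond the complete ones. -/
noncomputable def capacity (A m : ℝ) (d : ℕ) (α β : ℝ) : ℝ :=
  A * α + m * ∑ i ∈ Finset.range d, min α ((d - i : ℕ) * β)

theorem capacity_nonneg {A m : ℝ} (hA : 0 ≤ A) (hm : 0 ≤ m) (d : ℕ) (hα : 0 ≤ α) (hβ : 0 ≤ β) :
    0 ≤ capacity A m d α β :=
  add_nonneg (mul_nonneg hA hα) (mul_nonneg hm
    (Finset.sum_nonneg fun _ _ => le_min hα (mul_nonneg (Nat.cast_nonneg _) hβ)))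

theorem cutCost_ofReal {m x y : ℕ} (hm : 0 < m) (hy : d * m ≤ y) (hα : 0 ≤ α) (hβ : 0 ≤ β) :
    cutCost d m (ENNReal.ofReal α) (ENNReal.ofReal β) x y =
      ENNReal.ofReal (capacity x m d α β) := by
  rw [cutCost, sum_range_nodeCost_div hm hy, capacity, ENNReal.ofReal_add (by positivity)
    (mul_nonneg (Nat.cast_nonneg _) (Finset.sum_nonneg fun _ _ => by positivity)),
    ENNReal.ofReal_mul (Nat.cast_nonneg _), ENNReal.ofReal_mul (Nat.cast_nonneg _),
    ENNReal.ofReal_natCast, ENNReal.ofReal_natCast,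
    ENNReal.ofReal_sum_of_nonneg fun _ _ => by positivity]
  simp only [nodeCost_ofReal]

theorem maxFileSize_eq_ofReal_capacity (hl : l < u) (hk : k ≤ nbar * u) (hd : dbar < nbar)
    (hdk : dbar ≤ k / u) (hα : 0 ≤ α) (hβ : 0 ≤ β) :
    maxFileSize nbar u k dbar l α β =
      ENNReal.ofReal (capacity (baseCount u l k) (u - l : ℕ) dbar α β) := by
  rw [maxFileSize_eq_cutCost hl hk hd, cutCost_ofReal (Nat.sub_pos_of_lt hl) _ hα hβ]
  exact (Nat.mul_le_mul_right _ hdk).trans (Nat.le_add_right _ _)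

theorem fst_eq_zero_of_mem_firstNodes (hd : 0 < nbar) (hk : k ≤ u) {x : RackNode nbar u}
    (hx : x ∈ firstNodes nbar u k) : x.1 = ⟨0, hd⟩ := by
  have hx' : (x.2 : ℕ) + u * x.1 < k := by
    simpa only [firstNodes, Finset.mem_filter_univ, finProdFinEquiv_apply_val] using hx
  refine Fin.ext (Nat.eq_zero_of_not_pos fun hpos => ?_)
  have := Nat.le_mul_of_pos_right u hpos
  omega

theorem forall_le_flowMinCut_iff (hl : l < u) (hd : dbar < nbar) (hα : 0 ≤ α) (hβ : 0 ≤ β) :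
    (∀ (T : ℕ) (h : Fin T → RackRepair nbar u dbar l) (K : Finset (RackNode nbar u))
      (e : Fin nbar), (∀ x ∈ K, x.1 = e) → #K = l + 1 →
        ENNReal.ofReal (((l : ℝ) + 1) * α) ≤ flowMinCut α β h K) ↔ α ≤ dbar * β := by
  have hexcess : excessCount u l (l + 1) = 1 :=
    (excessCount_of_le hl hl).trans (Nat.add_sub_cancel_left l 1)
  have hbase : baseCount u l (l + 1) = l := by
    have := baseCount_add_excessCount hl.le (l + 1)
    omega
  have hcost : cutCost dbar (u - l) (ENNReal.ofReal α) (ENNReal.ofReal β)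
      (baseCount u l (l + 1)) (excessCount u l (l + 1)) =
        ENNReal.ofReal (l * α + min α (dbar * β)) := by
    rw [hexcess, hbase, cutCost, Finset.sum_range_one, Nat.zero_div, nodeCost_ofReal, Nat.sub_zero,
      ENNReal.ofReal_add (by positivity) (by positivity), ENNReal.ofReal_mul (Nat.cast_nonneg _),
      ENNReal.ofReal_natCast]
  constructor
  · intro H
    have hpos : 0 < nbar := Nat.zero_lt_of_lt hd
    have hk : l + 1 ≤ nbar * u := Nat.le_trans hl (Nat.le_mul_of_pos_left u hpos)
    obtain ⟨h, hh⟩ := exists_flowMinCut_le hl hk hd α β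
    have hle := (H _ h _ _ (fun _ => fst_eq_zero_of_mem_firstNodes hpos hl)
      (card_firstNodes hk)).trans hh
    rw [hcost, ENNReal.ofReal_le_ofReal_iff (by positivity)] at hle
    linarith [min_le_right α (dbar * β)]
  · intro hle T h K e _ hK
    refine Eq.trans_le ?_ (cutCost_le_flowMinCut hl α β h K)
    rw [hK, hcost, min_eq_left hle, add_mul, one_mul]

theorem isMETRRC_iff (hl : l < u) (hk : k ≤ nbar * u) (hd : dbar < nbar) (hdk : dbar ≤ k / u)
    {B : ℝ} (hB : 0 ≤ B) (α β : ℝ) :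
    IsMETRRC nbar u k dbar l B α β ↔ 0 ≤ α ∧ 0 ≤ β ∧
      B = capacity (baseCount u l k) (u - l : ℕ) dbar α β ∧ (0 < dbar → α ≤ dbar * β) := by
  unfold IsMETRRC
  refine and_congr_right fun hα => and_congr_right fun hβ => and_congr ?_ ?_
  · rw [maxFileSize_eq_ofReal_capacity hl hk hd hdk hα hβ, ENNReal.ofReal_eq_ofReal_iff hB
      (capacity_nonneg (Nat.cast_nonneg _) (Nat.cast_nonneg _) _ hα hβ)]
  · exact imp_congr_right fun _ => forall_le_flowMinCut_iff hl hd hα hβ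

end MaxFileSize

section Capacity

variable {A m α β : ℝ} {d : ℕ}

theorem capacity_le_mul_left (hm : 0 ≤ m) : capacity A m d α β ≤ (A + m * d) * α := by
  have hsum : ∑ i ∈ Finset.range d, min α ((d - i : ℕ) * β) ≤ d * α := by
    simpa using Finset.sum_le_card_nsmul (Finset.range d) (fun i => min α ((d - i : ℕ) * β)) α
      fun _ _ => min_le_left _ _
  unfold capacity
  linarith [mul_le_mul_of_nonneg_left hsum hm]

theorem capacity_lt_mul_left (hm : 0 < m) (hd : 0 < d) (h : β < α) :
    capacity A m d α β < (A + m * d) * α := by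
  have hsum : ∑ i ∈ Finset.range d, min α ((d - i : ℕ) * β) < ∑ _i ∈ Finset.range d, α := by
    refine Finset.sum_lt_sum (fun _ _ => min_le_left _ _)
      ⟨d - 1, Finset.mem_range.2 (Nat.sub_one_lt_of_lt hd), ?_⟩
    rw [Nat.sub_sub_self hd, Nat.cast_one, one_mul]
    exact (min_le_right _ _).trans_lt h
  rw [Finset.sum_const, Finset.card_range, nsmul_eq_mul] at hsum
  unfold capacity
  linarith [mul_lt_mul_of_pos_left hsum hm]

theorem capacity_self (hα : 0 ≤ α) : capacity A m d α α = (A + m * d) * α := by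
  have hmin : ∀ i ∈ Finset.range d, min α ((d - i : ℕ) * α) = α := fun i hi =>
    min_eq_left (le_mul_of_one_le_left hα
      (Nat.one_le_cast.2 (Nat.sub_pos_of_lt (Finset.mem_range.1 hi))))
  rw [capacity, Finset.sum_congr rfl hmin, Finset.sum_const, Finset.card_range, nsmul_eq_mul]
  ring

theorem sum_range_sub_mul (d : ℕ) (β : ℝ) :
    ∑ i ∈ Finset.range d, ((d - i : ℕ) : ℝ) * β = (d + 1) / 2 * (d * β) := by
  induction d with
  | zero => simp
  | succ d ih =>
    rw [Finset.sum_range_succ']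
    simp only [Nat.add_sub_add_right, ih, Nat.sub_zero]
    push_cast
    ring

theorem capacity_le_mul_right (hA : 0 ≤ A) (hm : 0 ≤ m) (h : α ≤ d * β) :
    capacity A m d α β ≤ (A + m * (d + 1) / 2) * (d * β) := by
  have hsum : ∑ i ∈ Finset.range d, min α ((d - i : ℕ) * β) ≤ (d + 1) / 2 * (d * β) := by
    rw [← sum_range_sub_mul]
    exact Finset.sum_le_sum fun _ _ => min_le_right _ _
  unfold capacity
  linarith [mul_le_mul_of_nonneg_left hsum hm, mul_le_mul_of_nonneg_left h hA]

theorem capacity_lt_mul_right (hA : 0 ≤ A) (hm : 0 < m) (hd : 0 < d) (h : α < d * β) :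
    capacity A m d α β < (A + m * (d + 1) / 2) * (d * β) := by
  have hsum : ∑ i ∈ Finset.range d, min α ((d - i : ℕ) * β) < (d + 1) / 2 * (d * β) := by
    rw [← sum_range_sub_mul]
    exact Finset.sum_lt_sum (fun _ _ => min_le_right _ _)
      ⟨0, Finset.mem_range.2 hd, (min_le_left _ _).trans_lt h⟩
  unfold capacity
  linarith [mul_lt_mul_of_pos_left hsum hm, mul_le_mul_of_nonneg_left h.le hA]

theorem capacity_mul_self (hβ : 0 ≤ β) :
    capacity A m d (d * β) β = (A + m * (d + 1) / 2) * (d * β) := by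
  have hmin : ∀ i ∈ Finset.range d, min (d * β) ((d - i : ℕ) * β) = (d - i : ℕ) * β :=
    fun i _ => min_eq_right (by gcongr; exact Nat.sub_le _ _)
  rw [capacity, Finset.sum_congr rfl hmin, sum_range_sub_mul]
  ring

end Capacity

section Points

variable {nbar u k dbar l : ℕ} {B α β α' β' : ℝ}

theorem IsMETMSRR.unique (h : IsMETMSRR nbar u k dbar l B α β)
    (h' : IsMETMSRR nbar u k dbar l B α' β') : α = α' ∧ β = β' := by
  have heq : (α, β) = (α', β') := toLex.injective <|
    (Prod.Lex.toLex_le_toLex.2 (h.2 _ _ h'.1)).antisymm (Prod.Lex.toLex_le_toLex.2 (h'.2 _ _ h.1))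
  exact Prod.ext_iff.1 heq

theorem IsMETMBRR.unique (h : IsMETMBRR nbar u k dbar l B α β)
    (h' : IsMETMBRR nbar u k dbar l B α' β') : α = α' ∧ dbar * β = dbar * β' := by
  have heq : (dbar * β, α) = (dbar * β', α') := toLex.injective <|
    (Prod.Lex.toLex_le_toLex.2 (h.2 _ _ h'.1)).antisymm (Prod.Lex.toLex_le_toLex.2 (h'.2 _ _ h.1))
  exact (Prod.ext_iff.1 heq).symm

theorem isMETMSRR_self (hl : l < u) (hk : k ≤ nbar * u) (hd : dbar < nbar) (hdk : dbar ≤ k / u)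
    (hd0 : 0 < dbar) (hα : 0 ≤ α) (hB : B = (baseCount u l k + (u - l : ℕ) * dbar) * α) :
    IsMETMSRR nbar u k dbar l B α α := by
  have hm : (0 : ℝ) < (u - l : ℕ) := Nat.cast_pos.2 (Nat.sub_pos_of_lt hl)
  have hC : (0 : ℝ) < baseCount u l k + (u - l : ℕ) * dbar :=
    add_pos_of_nonneg_of_pos (Nat.cast_nonneg _) (mul_pos hm (Nat.cast_pos.2 hd0))
  have hB0 : 0 ≤ B := hB ▸ mul_nonneg hC.le hα
  refine ⟨(isMETRRC_iff hl hk hd hdk hB0 _ _).2 ⟨hα, hα, hB.trans (capacity_self hα).symm, fun _ =>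
    le_mul_of_one_le_left hα (Nat.one_le_cast.2 hd0)⟩, fun α' β' h => ?_⟩
  obtain ⟨-, -, hcap, -⟩ := (isMETRRC_iff hl hk hd hdk hB0 _ _).1 h
  have hle : α ≤ α' :=
    le_of_mul_le_mul_left ((hB.symm.trans hcap).trans_le (capacity_le_mul_left hm.le)) hC
  refine hle.lt_or_eq.imp_right fun heq => ⟨heq, le_of_not_gt fun hlt => ?_⟩
  subst heq
  exact (capacity_lt_mul_left hm hd0 hlt).ne (hcap.symm.trans hB)

theorem isMETMBRR_mul_self (hl : l < u) (hk : k ≤ nbar * u) (hd : dbar < nbar)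
    (hdk : dbar ≤ k / u) (hd0 : 0 < dbar) (hβ : 0 ≤ β)
    (hB : B = (baseCount u l k + (u - l : ℕ) * ((dbar : ℝ) + 1) / 2) * (dbar * β)) :
    IsMETMBRR nbar u k dbar l B (dbar * β) β := by
  have hA : (0 : ℝ) ≤ baseCount u l k := Nat.cast_nonneg _
  have hm : (0 : ℝ) < (u - l : ℕ) := Nat.cast_pos.2 (Nat.sub_pos_of_lt hl)
  have hC : (0 : ℝ) < baseCount u l k + (u - l : ℕ) * ((dbar : ℝ) + 1) / 2 := by positivity
  have hB0 : 0 ≤ B := by rw [hB]; positivity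
  refine ⟨(isMETRRC_iff hl hk hd hdk hB0 _ _).2 ⟨by positivity, hβ,
    hB.trans (capacity_mul_self hβ).symm, fun _ => le_rfl⟩, fun α' β' h => ?_⟩
  obtain ⟨-, -, hcap, hαβ⟩ := (isMETRRC_iff hl hk hd hdk hB0 _ _).1 h
  have hle : dbar * β ≤ dbar * β' := le_of_mul_le_mul_left
    ((hB.symm.trans hcap).trans_le (capacity_le_mul_right hA hm.le (hαβ hd0))) hC
  refine hle.lt_or_eq.imp_right fun heq => ⟨heq, le_of_not_gt fun hlt => ?_⟩
  refine (capacity_lt_mul_right hA hm hd0 (hlt.trans_eq heq)).ne (hcap.symm.trans ?_)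
  rw [hB, heq]

theorem isMETMSRR_zero (hl : l < u) (hk : k ≤ nbar * u) (hn : 0 < nbar) (hA : 0 < baseCount u l k)
    (hα : 0 ≤ α) (hB : B = baseCount u l k * α) : IsMETMSRR nbar u k 0 l B α 0 := by
  have hB0 : 0 ≤ B := hB ▸ mul_nonneg (Nat.cast_nonneg _) hα
  unfold IsMETMSRR
  simp only [isMETRRC_iff hl hk hn (Nat.zero_le _) hB0, capacity, Finset.range_zero,
    Finset.sum_empty, mul_zero, add_zero, lt_irrefl, false_imp_iff, and_true]
  refine ⟨⟨hα, le_rfl, hB⟩, fun α' β' ⟨_, hβ', hB'⟩ => .inr ⟨?_, hβ'⟩⟩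
  exact mul_left_cancel₀ (Nat.cast_pos.2 hA).ne' (hB.symm.trans hB')

theorem isMETMSRR_iff (hl : l < u) (hk : k ≤ nbar * u) (hd : dbar < nbar) (hdk : dbar ≤ k / u)
    (hd0 : 0 < dbar) (hB : 0 ≤ B) : IsMETMSRR nbar u k dbar l B α β ↔
      α = B / (baseCount u l k + (u - l : ℕ) * dbar) ∧ α = β := by
  have hC : (0 : ℝ) < baseCount u l k + (u - l : ℕ) * dbar := add_pos_of_nonneg_of_pos
    (Nat.cast_nonneg _) (mul_pos (Nat.cast_pos.2 (Nat.sub_pos_of_lt hl)) (Nat.cast_pos.2 hd0))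
  have hpoint := isMETMSRR_self hl hk hd hdk hd0 (div_nonneg hB hC.le)
    (mul_div_cancel₀ B hC.ne').symm
  refine ⟨fun h => ?_, ?_⟩
  · obtain ⟨hα, hβ⟩ := h.unique hpoint
    exact ⟨hα, hα.trans hβ.symm⟩
  · rintro ⟨rfl, rfl⟩
    exact hpoint

theorem isMETMBRR_iff (hl : l < u) (hk : k ≤ nbar * u) (hd : dbar < nbar) (hdk : dbar ≤ k / u)
    (hd0 : 0 < dbar) (hB : 0 ≤ B) : IsMETMBRR nbar u k dbar l B α β ↔
      α = B / (baseCount u l k + (u - l : ℕ) * ((dbar : ℝ) + 1) / 2) ∧ α = dbar * β := by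
  have hm : (0 : ℝ) < (u - l : ℕ) := Nat.cast_pos.2 (Nat.sub_pos_of_lt hl)
  have hd0' : (0 : ℝ) < dbar := Nat.cast_pos.2 hd0
  have hC : (0 : ℝ) < baseCount u l k + (u - l : ℕ) * ((dbar : ℝ) + 1) / 2 := by positivity
  have hpoint : ∀ β, dbar * β = B / (baseCount u l k + (u - l : ℕ) * ((dbar : ℝ) + 1) / 2) →
      IsMETMBRR nbar u k dbar l B (dbar * β) β := fun β hβ =>
    isMETMBRR_mul_self hl hk hd hdk hd0
      (nonneg_of_mul_nonneg_right (hβ ▸ div_nonneg hB hC.le) hd0')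
      (by rw [hβ, mul_div_cancel₀ B hC.ne'])
  refine ⟨fun h => ?_, ?_⟩
  · have hβ := mul_div_cancel₀
      (B / (baseCount u l k + (u - l : ℕ) * ((dbar : ℝ) + 1) / 2)) hd0'.ne'
    obtain ⟨hα, hαβ⟩ := h.unique (hpoint _ hβ)
    exact ⟨hα.trans hβ, hα.trans hαβ.symm⟩
  · rintro ⟨hα, rfl⟩
    exact hpoint β hα

theorem isMETMSRR_zero_iff (hl : l < u) (hk : k ≤ nbar * u) (hn : 0 < nbar)
    (hA : 0 < baseCount u l k) (hB : 0 ≤ B) :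
    IsMETMSRR nbar u k 0 l B α β ↔ α = B / baseCount u l k ∧ β = 0 := by
  have hA' : (0 : ℝ) < baseCount u l k := Nat.cast_pos.2 hA
  have hpoint := isMETMSRR_zero hl hk hn hA (div_nonneg hB hA'.le) (mul_div_cancel₀ B hA'.ne').symm
  refine ⟨fun h => h.unique hpoint, ?_⟩
  rintro ⟨rfl, rfl⟩
  exact hpoint

end Points

theorem corollary2_general (nbar u k dbar l kbar u₀ : ℕ) (hl : l < u) (hk : k ≤ nbar * u)
    (hkbar : kbar = k / u) (hu₀ : u₀ = k - kbar * u) (hdn : dbar < nbar) (hdbar : dbar ≤ kbar)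
    (B : ℝ) (hB : 0 ≤ B) :
    (0 < dbar → ∀ α β : ℝ,
      (IsMETMSRR nbar u k dbar l B α β ↔
        α = B / (kbar * l + (min u₀ l : ℕ) + ((u : ℝ) - l) * dbar) ∧ α = β) ∧
      (IsMETMBRR nbar u k dbar l B α β ↔
        α = B / (kbar * l + (min u₀ l : ℕ) + ((u : ℝ) - l) * ((dbar : ℝ) + 1) / 2) ∧
          α = dbar * β)) ∧
    (dbar = 0 → 0 < k → 1 ≤ l → ∀ α β : ℝ,
      (IsMETMSRR nbar u k dbar l B α β ↔
        α = B / (kbar * l + (min u₀ l : ℕ)) ∧ β = 0)) := by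
  have hbase : (kbar * l + (min u₀ l : ℕ) : ℝ) = baseCount u l k := by
    rw [hu₀, hkbar, ← Nat.mod_eq_sub_div_mul, baseCount, Nat.cast_add, Nat.cast_mul]
  rw [hbase, ← Nat.cast_sub hl.le]
  subst hkbar
  refine ⟨fun hd0 α β => ⟨isMETMSRR_iff hl hk hdn hdbar hd0 hB,
    isMETMBRR_iff hl hk hdn hdbar hd0 hB⟩, ?_⟩
  rintro rfl hk0 hl0 α β
  exact isMETMSRR_zero_iff hl hk hdn (baseCount_pos hl0 hk0) hB

theorem corollary2 (nbar u k dbar l kbar u₀ : ℕ) (hl : l < u) (hk : k ≤ nbar * u)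
    (hkbar : kbar = k / u) (hu₀ : u₀ = k - kbar * u) (hdbar : dbar < kbar)
    (B : ℝ) (hB : 0 < B) :
    (0 < dbar → ∀ α β : ℝ,
      (IsMETMSRR nbar u k dbar l B α β ↔
        α = B / (kbar * l + (min u₀ l : ℕ) + ((u : ℝ) - l) * dbar) ∧ α = β) ∧
      (IsMETMBRR nbar u k dbar l B α β ↔
        α = B / (kbar * l + (min u₀ l : ℕ) + ((u : ℝ) - l) * ((dbar : ℝ) + 1) / 2) ∧
          α = dbar * β)) ∧
    (dbar = 0 → 1 ≤ l → ∀ α β : ℝ,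
      (IsMETMSRR nbar u k dbar l B α β ↔
        α = B / (kbar * l + (min u₀ l : ℕ)) ∧ β = 0)) := by
  have hkpos : 0 < k := Nat.pos_of_ne_zero fun hk0 => by simp [hkbar, hk0] at hdbar
  have hkn : k / u ≤ nbar := Nat.div_le_of_le_mul (hk.trans_eq (mul_comm ..))
  have hdn : dbar < nbar := hdbar.trans_le (hkbar.trans_le hkn)
  obtain ⟨ha, hb⟩ := corollary2_general nbar u k dbar l kbar u₀ hl hk hkbar hu₀ hdn hdbar.le B hB.le
  exact ⟨ha, fun hd0 => hb hd0 hkpos⟩
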